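/- Let $G$ be a finite simple graph. Denote by $\Delta(G)$ its maximum degree and by $\chi_G$ its chromatic polynomial, i.e. the unique monic polynomial of degree $|V(G)|$ such that for every positive integer $q$, $\chi_G(q)$ is the number of proper $q$-colorings of $G$. Suppose that $G$ is claw-free, i.e. that $G$ does not contain the tree on $4$ vertices with $3$ leaves as an induced subgraph. If $\chi_G(z)=0$ for $z\in\mathbb{C}$, then $|z|\le 3.81\,\Delta(G)$. -/

import Mathlib

namespace SimpleGraph

/-- The claw: the tree on `4` vertices with `3` leaves. -/
def claw : SimpleGraph (Fin 4) := starGraph 0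

/-- A graph is claw-free if it does not contain the claw as an induced subgraph. -/
def IsClawFree {V : Type*} (G : SimpleGraph V) : Prop := ¬ claw.IsIndContained G

/-- `P` is a chromatic polynomial of the `n`-vertex graph `G`: it is monic of degree `n`, and for
every positive integer `q` its value at `q` is the number of proper `q`-colorings of `G`. -/
def IsChromaticPolynomial {V : Type*} [Fintype V] (G : SimpleGraph V) (P : Polynomial ℤ) : Prop :=
  P.Monic ∧ P.natDegree = Fintype.card V ∧
    ∀ q : ℕ, 0 < q → P.eval (q : ℤ) = (Nat.card (G.Coloring (Fin q)) : ℤ)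

/-- Helper: the coloring given by a partition of the vertices into independent sets together with
an injective assignment of colors to the parts. -/
def coloringOfSetoid {V : Type*} (G : SimpleGraph V) (q : ℕ)
    (p : Σ s : {s : Setoid V // ∀ u v, G.Adj u v → ¬ s u v}, (Quotient s.1 ↪ Fin q)) :
    G.Coloring (Fin q) :=
  Coloring.mk (fun v => p.2 (Quotient.mk p.1.1 v))
    (fun {u v} h e => p.1.2 u v h (Quotient.exact (p.2.injective e)))

/-- Helper: every proper coloring arises exactly once in this way. -/
theorem coloringOfSetoid_bijective {V : Type*} (G : SimpleGraph V) (q : ℕ) :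
    Function.Bijective (coloringOfSetoid G q) := by
  constructor
  · rintro ⟨⟨s, hs⟩, f⟩ ⟨⟨t, ht⟩, g⟩ h
    have hv : ∀ v, f (Quotient.mk s v) = g (Quotient.mk t v) := fun v => DFunLike.congr_fun h v
    have hst : s = t := by
      ext u v
      constructor
      · intro e
        apply Quotient.exact
        apply g.injective
        rw [← hv, ← hv, Quotient.sound e]
      · intro e
        apply Quotient.exact
        apply f.injective
        rw [hv, hv, Quotient.sound e]
    subst hst
    have hfg : f = g := by
      ext x
      induction x using Quotient.inductionOn with
      | h v => rw [hv v]
    rw [hfg]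
  · intro c
    refine ⟨⟨⟨Setoid.ker c, fun _ _ h => c.valid h⟩, ⟨Quotient.lift c (fun _ _ h => h), ?_⟩⟩, ?_⟩
    · rintro ⟨a⟩ ⟨b⟩ h
      exact Quotient.sound h
    · ext v
      rfl

/-- Every finite graph has exactly one chromatic polynomial. -/
theorem existsUnique_isChromaticPolynomial {V : Type*} [Fintype V] (G : SimpleGraph V) :
    ∃! P : Polynomial ℤ, G.IsChromaticPolynomial P := by
  classical
  have hfin : Finite (Setoid V) :=
    Finite.of_injective (fun s : Setoid V => fun u v => s u v) (by
      intro s t h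
      ext u v
      exact iff_of_eq (congrFun (congrFun h u) v))
  let I := {s : Setoid V // ∀ u v, G.Adj u v → ¬ s u v}
  have : Fintype I := Fintype.ofFinite I
  let bot : I := ⟨⊥, fun u v h e => h.ne e⟩
  let k : I → ℕ := fun s => Fintype.card (Quotient s.1)
  have hbot : k bot = Fintype.card V :=
    (Fintype.card_of_bijective (f := fun v => Quotient.mk bot.1 v)
      ⟨fun u v h => Quotient.exact h, Quotient.mk_surjective⟩).symm
  have hlt : ∀ s : I, s ≠ bot → k s < Fintype.card V := by
    intro s hs
    refine lt_of_le_of_ne (Fintype.card_le_of_surjective _ (Quotient.mk_surjective (s := s.1))) ?_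
    intro h
    apply hs
    have hb := (Fintype.bijective_iff_surjective_and_card (fun v => Quotient.mk s.1 v)).2
      ⟨Quotient.mk_surjective, h.symm⟩
    apply Subtype.ext
    ext u v
    exact ⟨fun e => hb.1 (Quotient.sound e), fun e => by
      have e' : u = v := e
      rw [e']⟩
  let R : Polynomial ℤ := ∑ s ∈ Finset.univ.erase bot, descPochhammer ℤ (k s)
  have hR : R.degree < (descPochhammer ℤ (k bot)).degree := by
    rw [Polynomial.degree_eq_natDegree (monic_descPochhammer ℤ _).ne_zero,
      descPochhammer_natDegree, hbot]
    refine lt_of_le_of_lt (Polynomial.degree_sum_le _ _) ?_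
    refine (Finset.sup_lt_iff (WithBot.bot_lt_coe _)).2 ?_
    intro s hs
    rw [Polynomial.degree_eq_natDegree (monic_descPochhammer ℤ _).ne_zero,
      descPochhammer_natDegree]
    exact_mod_cast hlt s (Finset.ne_of_mem_erase hs)
  have hsum : ∑ s : I, descPochhammer ℤ (k s) = descPochhammer ℤ (k bot) + R :=
    (Finset.add_sum_erase _ _ (Finset.mem_univ bot)).symm
  refine ⟨∑ s : I, descPochhammer ℤ (k s), ⟨?_, ?_, ?_⟩, ?_⟩
  · rw [hsum]
    exact (monic_descPochhammer ℤ _).add_of_left hR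
  · rw [hsum, Polynomial.natDegree_add_eq_left_of_degree_lt hR, descPochhammer_natDegree, hbot]
  · intro q _
    rw [← Nat.card_congr (Equiv.ofBijective _ (coloringOfSetoid_bijective G q)),
      Nat.card_eq_fintype_card, Fintype.card_sigma, Polynomial.eval_finsetSum]
    push_cast
    refine Finset.sum_congr rfl fun s _ => ?_
    rw [descPochhammer_eval_eq_descFactorial, Fintype.card_embedding_eq, Fintype.card_fin]
  · rintro Q ⟨_, _, hQ⟩
    refine Polynomial.eq_of_infinite_eval_eq _ _ ?_
    refine Set.Infinite.mono ?_
      (Set.infinite_range_of_injective (f := fun n : ℕ => ((n + 1 : ℕ) : ℤ))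
        (fun a b h => by simpa using h))
    rintro _ ⟨n, rfl⟩
    show Q.eval ((n + 1 : ℕ) : ℤ) = _
    rw [hQ (n + 1) n.succ_pos,
      ← Nat.card_congr (Equiv.ofBijective _ (coloringOfSetoid_bijective G (n + 1))),
      Nat.card_eq_fintype_card, Fintype.card_sigma, Polynomial.eval_finsetSum]
    push_cast
    refine Finset.sum_congr rfl fun s _ => ?_
    have := descPochhammer_eval_eq_descFactorial ℤ (n + 1) (k s)
    push_cast at this
    rw [this, Fintype.card_embedding_eq, Fintype.card_fin]

/-- The chromatic polynomial of a finite graph `G` with `n` vertices: the unique monic polynomial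
of degree `n` whose value at every positive integer `q` is the number of proper `q`-colorings
of `G`. -/
noncomputable def chromaticPolynomial {V : Type*} [Fintype V] (G : SimpleGraph V) :
    Polynomial ℤ :=
  (existsUnique_isChromaticPolynomial G).choose

/-- The chromatic polynomial has its defining property. -/
theorem chromaticPolynomial_spec {V : Type*} [Fintype V] (G : SimpleGraph V) :
    G.IsChromaticPolynomial G.chromaticPolynomial :=
  (existsUnique_isChromaticPolynomial G).choose_spec.1

end SimpleGraph

/-!
For `J ⊆ W`, let `N_J^W(q)` be the number of proper `q`-colorings of `G[W]` that give all of `J` one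
fixed color. It is a polynomial in `q` (`rootedPolynomial`), with `N_∅^W = χ_{G[W]}`. By the symmetry
of the colors `N_∅^W = q N_{u}^W` (`rootedPolynomial_empty_right`). For `u ∈ J`, removing `u` leaves
the colorings of `G[W \ u]` in which no neighbor of `u` has the fixed color, so that by
inclusion-exclusion (`rootedPolynomial_eq_sum`)

  `N_J^W = ∑_K (-1)^|K| N_{(J \ u) ∪ K}^{W \ u}`, the sum over sets `K ⊆ W` of neighbors of `u`.

Only independent `K` contribute. In a claw-free graph such a `K` has at most two elements, and by
Mantel's theorem at most `Δ ^ 2 / 4` of them are pairs; hence (`indepSum_le`) for `t ≥ 0` the sum of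
`t ^ |K|` over these `K` is at most `(1 + t Δ / 2) ^ 2`.

Now let `z ≠ 0` with `|z| ≥ 7/2 Δ`, and `c = 1 / |z|`. Induction on `W`
(`norm_aeval_rootedPolynomial_le`) gives `|χ_{W \ u}| ≤ 7/4 c |χ_W|` and, for nonempty `J`,
`|N_J^W| ≤ (7c) ^ |J| / 7 * |χ_W|` at the point `z`. Indeed, with `t = 7c` the above sum is at
most `4`. In the identity for `J = {u}` the term `K = ∅` is `χ_{W \ u}`, and the others are together at
most `(4 - 1) / 7` of it, so `|N_{u}^W| ≥ 4/7 |χ_{W \ u}|`. For `|J| ≥ 2` the identity costs a factor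
`4`, and passing from `χ_{W \ u}` to `χ_W` a factor `7/4 c`, together `7c`. In particular
`χ_G(z) ≠ 0`, so all zeros lie in the disk of radius `7/2 Δ`.
-/

namespace SimpleGraph

open Finset Polynomial

variable {V : Type*}

/-! ### Independent subsets of a neighborhood -/

section IndepSum

open Classical in
/-- The independence polynomial of `G[N]`, evaluated at `t`. -/
noncomputable def indepSum (G : SimpleGraph V) (t : ℝ) (N : Finset V) : ℝ :=
  ∑ J ∈ N.powerset, if G.IsIndepSet (J : Set V) then t ^ #J else 0

/-- If every member of a family of subsets of `M` is empty or a singleton from `D`, its generating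
function is at most `1 + t * #D`. -/
theorem sum_pow_card_le_of_card_le_one [DecidableEq V] {t : ℝ} (ht : 0 ≤ t) (M D : Finset V)
    (p : Finset V → Prop) [DecidablePred p] (hp : ∀ J ⊆ M, p J → J = ∅ ∨ ∃ w ∈ D, J = {w}) :
    (∑ J ∈ M.powerset, if p J then t ^ #J else 0) ≤ 1 + t * #D := by
  rw [← Finset.sum_filter]
  calc ∑ J ∈ M.powerset with p J, t ^ #J
      ≤ ∑ J ∈ insert ∅ (D.image fun w => ({w} : Finset V)), t ^ #J := by
        refine Finset.sum_le_sum_of_subset_of_nonneg ?_ fun _ _ _ => by positivity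
        intro J hJ
        rw [Finset.mem_filter, Finset.mem_powerset] at hJ
        rcases hp J hJ.1 hJ.2 with rfl | ⟨w, hw, rfl⟩
        · exact Finset.mem_insert_self _ _
        · exact Finset.mem_insert_of_mem (Finset.mem_image_of_mem _ hw)
    _ = 1 + t * #D := by
        rw [Finset.sum_insert (by simp), Finset.sum_image (by simp)]
        simp [mul_comm]

/-- Mantel's theorem in generating-function form: if `N` has no three independent vertices, it has
at most `#N ^ 2 / 4` independent pairs. Two nonadjacent vertices of `N` lie together in
at most `#N - 1` independent pairs, since each further vertex is adjacent to one of them; deleting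
both gives the induction. -/
theorem indepSum_le (G : SimpleGraph V) {t : ℝ} (ht : 0 ≤ t) (N : Finset V)
    (h3 : ∀ a ∈ N, ∀ b ∈ N, ∀ c ∈ N, a ≠ b → a ≠ c → b ≠ c →
      G.Adj a b ∨ G.Adj a c ∨ G.Adj b c) :
    G.indepSum t N ≤ (1 + t * #N / 2) ^ 2 := by
  classical
  induction hn : #N using Nat.strong_induction_on generalizing N with
  | _ n ih =>
  subst hn
  by_cases hclique : ∀ a ∈ N, ∀ b ∈ N, a ≠ b → G.Adj a b
  · have := sum_pow_card_le_of_card_le_one ht N N (fun J => G.IsIndepSet (J : Set V)) (by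
      intro J hJ hI
      rcases J.eq_empty_or_nonempty with rfl | ⟨w, hw⟩
      · exact Or.inl rfl
      · refine Or.inr ⟨w, hJ hw, Finset.eq_singleton_iff_unique_mem.2 ⟨hw, fun x hx => ?_⟩⟩
        by_contra hne
        exact hI hx hw hne (hclique x (hJ hx) w (hJ hw) hne))
    unfold indepSum
    nlinarith [sq_nonneg (t * #N / 2)]
  · push Not at hclique
    obtain ⟨a, ha, b, hb, hab, hnadj⟩ := hclique
    obtain ⟨M, hM⟩ : ∃ M, M = (N.erase a).erase b := ⟨_, rfl⟩
    have hbN : b ∈ N.erase a := Finset.mem_erase.2 ⟨hab.symm, hb⟩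
    have hMN : M ⊆ N := hM ▸ (Finset.erase_subset _ _).trans (Finset.erase_subset _ _)
    have haM : a ∉ M := by simp [hM]
    have hbM : b ∉ M := by simp [hM]
    have hN : N = insert a (insert b M) := by
      rw [hM, Finset.insert_erase hbN, Finset.insert_erase ha]
    have haM' : a ∉ insert b M := by simp [hab, haM]
    have hcard : #N = #M + 2 := by
      rw [hN, Finset.card_insert_of_notMem haM', Finset.card_insert_of_notMem hbM]
    -- An independent set containing the vertex `v` has at most one further vertex.
    have hone : ∀ v ∈ N, v ∉ M → (∑ J ∈ M.powerset,
        if G.IsIndepSet ((insert v J : Finset V) : Set V) then t ^ #(insert v J) else 0) ≤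
          t * (1 + t * #{w ∈ M | ¬ G.Adj v w}) := by
      intro v hv hvM
      refine le_trans (le_of_eq ?_) (mul_le_mul_of_nonneg_left
        (sum_pow_card_le_of_card_le_one ht M {w ∈ M | ¬ G.Adj v w}
          (fun J => G.IsIndepSet ((insert v J : Finset V) : Set V)) ?_) ht)
      · rw [Finset.mul_sum]
        refine Finset.sum_congr rfl fun J hJ => ?_
        rw [Finset.card_insert_of_notMem fun h => hvM (Finset.mem_powerset.1 hJ h), mul_ite,
          mul_zero, pow_succ']
      · intro J hJ hI
        rcases J.eq_empty_or_nonempty with rfl | ⟨w, hw⟩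
        · exact Or.inl rfl
        · have key : ∀ x ∈ J, ¬ G.Adj v x := fun x hx hadj =>
            hI (by simp) (by simp [hx]) hadj.ne hadj
          refine Or.inr ⟨w, Finset.mem_filter.2 ⟨hJ hw, key w hw⟩,
            Finset.eq_singleton_iff_unique_mem.2 ⟨hw, fun x hx => ?_⟩⟩
          by_contra hne
          rcases h3 v hv x (hMN (hJ hx)) w (hMN (hJ hw)) (fun h => hvM (h ▸ hJ hx))
            (fun h => hvM (h ▸ hJ hw)) hne with h | h | h
          · exact key x hx h
          · exact key w hw h
          · exact hI (by simp [hx]) (by simp [hw]) hne h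
    have htwo : (∑ J ∈ M.powerset, if G.IsIndepSet ((insert a (insert b J) : Finset V) : Set V)
        then t ^ #(insert a (insert b J)) else 0) ≤ t ^ 2 := by
      rw [Finset.sum_eq_single ∅]
      · split_ifs
        · simp [Finset.card_pair hab]
        · positivity
      · intro J hJ hne
        obtain ⟨w, hw⟩ := Finset.nonempty_iff_ne_empty.2 hne
        have hwM := Finset.mem_powerset.1 hJ hw
        have hwa : a ≠ w := fun h => haM (h ▸ hwM)
        have hwb : b ≠ w := fun h => hbM (h ▸ hwM)
        refine if_neg fun hI => ?_
        rcases h3 a ha b hb w (hMN hwM) hab hwa hwb with h | h | h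
        · exact hnadj h
        · exact hI (by simp) (by simp [hw]) hwa h
        · exact hI (by simp) (by simp [hw]) hwb h
      · simp
    have hdisj : #{w ∈ M | ¬ G.Adj a w} + #{w ∈ M | ¬ G.Adj b w} ≤ #M := by
      rw [← Finset.card_union_of_disjoint]
      · exact Finset.card_le_card (Finset.union_subset (Finset.filter_subset _ _)
          (Finset.filter_subset _ _))
      · rw [Finset.disjoint_filter]
        intro w hw h1 h2
        rcases h3 a ha b hb w (hMN hw) hab (fun h => haM (h ▸ hw)) (fun h => hbM (h ▸ hw))
          with h | h | h
        · exact hnadj h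
        · exact h1 h
        · exact h2 h
    have hM' := ih #M (by omega) M (fun x hx y hy w hw =>
      h3 x (hMN hx) y (hMN hy) w (hMN hw)) rfl
    have hdecomp : G.indepSum t N = G.indepSum t M +
        (∑ J ∈ M.powerset,
          if G.IsIndepSet ((insert b J : Finset V) : Set V) then t ^ #(insert b J) else 0) +
        ((∑ J ∈ M.powerset,
          if G.IsIndepSet ((insert a J : Finset V) : Set V) then t ^ #(insert a J) else 0) +
        ∑ J ∈ M.powerset, if G.IsIndepSet ((insert a (insert b J) : Finset V) : Set V)
          then t ^ #(insert a (insert b J)) else 0) := by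
      unfold indepSum
      rw [hN, Finset.sum_powerset_insert haM', Finset.sum_powerset_insert hbM,
        Finset.sum_powerset_insert hbM]
    have h1 := hone a ha haM
    have h2 := hone b hb hbM
    have h4 : (#{w ∈ M | ¬ G.Adj a w} : ℝ) + #{w ∈ M | ¬ G.Adj b w} ≤ #M := by
      exact_mod_cast hdisj
    have h5 := mul_le_mul_of_nonneg_left h4 (sq_nonneg t)
    have h6 : (#N : ℝ) = #M + 2 := by exact_mod_cast hcard
    rw [hdecomp, h6]
    nlinarith

/-- Three pairwise nonadjacent neighbors of a vertex would induce a claw. -/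
theorem IsClawFree.exists_adj {G : SimpleGraph V} (hG : G.IsClawFree) {u a b c : V}
    (ha : G.Adj u a) (hb : G.Adj u b) (hc : G.Adj u c) (hab : a ≠ b) (hac : a ≠ c)
    (hbc : b ≠ c) : G.Adj a b ∨ G.Adj a c ∨ G.Adj b c := by
  by_contra! h
  obtain ⟨h1, h2, h3⟩ := h
  have h1' : ¬ G.Adj b a := fun h => h1 h.symm
  have h2' : ¬ G.Adj c a := fun h => h2 h.symm
  have h3' : ¬ G.Adj c b := fun h => h3 h.symm
  refine hG ⟨⟨⟨![u, a, b, c], ?_⟩, ?_⟩⟩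
  · intro i j hij
    fin_cases i <;> fin_cases j <;>
      simp_all [ha.ne, ha.ne', hb.ne, hb.ne', hc.ne, hc.ne', hab.symm, hac.symm, hbc.symm]
  · intro i j
    change G.Adj (![u, a, b, c] i) (![u, a, b, c] j) ↔ claw.Adj i j
    fin_cases i <;> fin_cases j <;>
      simp [claw, starGraph_adj, ha, hb, hc, ha.symm, hb.symm, hc.symm, h1, h2, h3, h1', h2', h3']

end IndepSum

/-! ### Colorings with a prescribed monochromatic set -/

section Count

open Classical in
theorem erase_union_subset (G : SimpleGraph V) {W J K : Finset V} {u : V} (hJ : J ⊆ W)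
    (hK : K ∈ ({w ∈ W | G.Adj u w} : Finset V).powerset) : J.erase u ∪ K ⊆ W.erase u := by
  refine Finset.union_subset (Finset.erase_subset_erase u hJ) fun w hw => ?_
  have h := Finset.mem_filter.1 (Finset.mem_powerset.1 hK hw)
  exact Finset.mem_erase.2 ⟨h.2.ne', h.1⟩

variable [Fintype V]

open Classical in
/-- The number of proper colorings of the induced subgraph `G[W]` with colors `0, …, q` that give
every vertex of `J` the color `0`. A coloring of `G[W]` is encoded as a function on all of `V` that
vanishes outside `W`. -/
noncomputable def rootedCount (G : SimpleGraph V) (q : ℕ) (W J : Finset V) : ℕ :=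
  #{f : V → Fin (q + 1) | (∀ u ∈ W, ∀ v ∈ W, G.Adj u v → f u ≠ f v) ∧
    ∀ v, v ∈ J ∨ v ∉ W → f v = 0}

variable (G : SimpleGraph V) (q : ℕ)

theorem rootedCount_empty (J : Finset V) : G.rootedCount q ∅ J = 1 := by
  classical
  rw [rootedCount, Finset.card_eq_one]
  refine ⟨fun _ => 0, ?_⟩
  ext f
  simp [funext_iff]

theorem rootedCount_eq_zero {W J : Finset V} (hJ : J ⊆ W) (h : ¬ G.IsIndepSet (J : Set V)) :
    G.rootedCount q W J = 0 := by
  classical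
  rw [rootedCount, Finset.card_eq_zero, Finset.filter_eq_empty_iff]
  rintro f - ⟨h1, h2⟩
  refine h fun u hu v hv _ huv => h1 u (hJ hu) v (hJ hv) huv ?_
  rw [h2 u (Or.inl hu), h2 v (Or.inl hv)]

theorem rootedCount_univ : G.rootedCount q univ ∅ = Nat.card (G.Coloring (Fin (q + 1))) := by
  classical
  rw [rootedCount, ← Fintype.card_subtype, ← Nat.card_eq_fintype_card]
  exact Nat.card_congr
    { toFun := fun f => Coloring.mk f.1 fun {u v} h => f.2.1 u (mem_univ u) v (mem_univ v) h
      invFun := fun c => ⟨c, fun _ _ _ _ h => c.valid h, fun v hv => by simp at hv⟩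
      left_inv := fun _ => rfl
      right_inv := fun _ => rfl }

/-- All colors being alike, the color of `u` is `0` in one out of `q + 1` colorings. -/
theorem rootedCount_empty_right {W : Finset V} {u : V} (hu : u ∈ W) :
    G.rootedCount q W ∅ = (q + 1) * G.rootedCount q W {u} := by
  classical
  rw [rootedCount, Finset.card_eq_sum_card_fiberwise (f := fun f => f u) (t := univ)
    (fun _ _ => Finset.mem_coe.2 (Finset.mem_univ _)),
    Finset.sum_const_nat (m := G.rootedCount q W {u})]
  · simp
  intro a _
  let r : (V → Fin (q + 1)) → V → Fin (q + 1) :=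
    fun f v => if v ∈ W then Equiv.swap 0 a (f v) else 0
  refine Finset.card_bij' (fun f _ => r f) (fun f _ => r f) ?_ ?_ ?_ ?_
  · intro f hf
    simp only [Finset.mem_filter, Finset.mem_univ, true_and] at hf ⊢
    obtain ⟨⟨h1, h2⟩, h3⟩ := hf
    refine ⟨fun x hx y hy hxy => ?_, fun v hv => ?_⟩
    · simpa [r, hx, hy] using h1 x hx y hy hxy
    · rcases hv with hv | hv
      · rw [Finset.mem_singleton] at hv
        subst hv
        simp [r, hu, h3]
      · simp [r, hv]
  · intro f hf
    simp only [Finset.mem_filter, Finset.mem_univ, true_and] at hf ⊢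
    obtain ⟨h1, h2⟩ := hf
    refine ⟨⟨fun x hx y hy hxy => ?_, fun v hv => ?_⟩, ?_⟩
    · simpa [r, hx, hy] using h1 x hx y hy hxy
    · simp [r, hv.resolve_left (Finset.notMem_empty v)]
    · simp [r, hu, h2 u (Or.inl (Finset.mem_singleton_self u))]
  · intro f hf
    simp only [Finset.mem_filter, Finset.mem_univ, true_and] at hf
    ext1 v
    by_cases hv : v ∈ W
    · simp [r, hv]
    · simp [r, hv, hf.1.2 v (Or.inr hv)]
  · intro f hf
    simp only [Finset.mem_filter, Finset.mem_univ, true_and] at hf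
    ext1 v
    by_cases hv : v ∈ W
    · simp [r, hv]
    · simp [r, hv, hf.2 v (Or.inr hv)]

open Classical in
/-- Removal of a vertex `u` colored `0`: what remains is a coloring of `G[W \ {u}]` in which no
neighbor of `u` has the color `0`, and inclusion-exclusion over those neighbors applies. -/
theorem rootedCount_eq_sum {W J : Finset V} {u : V} (huW : u ∈ W) (huJ : u ∈ J) :
    (G.rootedCount q W J : ℤ) = ∑ K ∈ ({w ∈ W | G.Adj u w} : Finset V).powerset,
      (-1) ^ #K * (G.rootedCount q (W.erase u) (J.erase u ∪ K) : ℤ) := by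
  have key := Finset.inclusion_exclusion_sum_inf_compl ({w ∈ W | G.Adj u w} : Finset V)
    (fun w => ({f : V → Fin (q + 1) | f w = 0} : Finset (V → Fin (q + 1))))
    (fun f => if (∀ x ∈ W.erase u, ∀ y ∈ W.erase u, G.Adj x y → f x ≠ f y) ∧
      (∀ v, v ∈ J ∨ v ∉ W → f v = 0) then (1 : ℤ) else 0)
  rw [← Finset.sum_filter, Finset.sum_const, nsmul_one] at key
  have hmem : ∀ (K : Finset V) (f : V → Fin (q + 1)),
      f ∈ K.inf (fun w => ({f : V → Fin (q + 1) | f w = 0} : Finset (V → Fin (q + 1)))) ↔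
        ∀ w ∈ K, f w = 0 := by
    intro K f
    simp [Finset.mem_inf]
  have hmem' : ∀ (K : Finset V) (f : V → Fin (q + 1)),
      f ∈ K.inf (fun w => ({f : V → Fin (q + 1) | f w = 0} : Finset (V → Fin (q + 1)))ᶜ) ↔
        ∀ w ∈ K, f w ≠ 0 := by
    intro K f
    simp [Finset.mem_inf]
  convert key using 1
  · rw [rootedCount]
    congr 2
    ext f
    simp only [Finset.mem_filter, Finset.mem_univ, true_and, hmem', Finset.mem_erase]
    constructor
    · rintro ⟨h1, h2⟩
      refine ⟨fun w hw => ?_, fun x hx y hy => h1 x hx.2 y hy.2, h2⟩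
      rw [← h2 u (Or.inl huJ)]
      exact (h1 u huW w hw.1 hw.2).symm
    · rintro ⟨h1, h2, h3⟩
      refine ⟨fun x hx y hy hxy => ?_, h3⟩
      have h0 := h3 u (Or.inl huJ)
      by_cases hxu : x = u
      · subst hxu
        rw [h0]
        exact (h1 y ⟨hy, hxy⟩).symm
      · by_cases hyu : y = u
        · subst hyu
          rw [h0]
          exact h1 x ⟨hx, hxy.symm⟩
        · exact h2 x ⟨hxu, hx⟩ y ⟨hyu, hy⟩ hxy
  · refine Finset.sum_congr rfl fun K hK => ?_
    rw [← Finset.sum_filter, Finset.sum_const, nsmul_one, zsmul_eq_mul, rootedCount]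
    push_cast
    congr 3
    ext f
    simp only [Finset.mem_filter, Finset.mem_univ, true_and, hmem, Finset.mem_union,
      Finset.mem_erase]
    constructor
    · rintro ⟨h1, h2⟩
      refine ⟨fun w hw => h2 w (Or.inl (Or.inr hw)), h1, fun v hv => ?_⟩
      by_cases hvu : v = u
      · exact h2 v (Or.inr fun h => h.1 hvu)
      · exact h2 v (hv.imp (fun h => Or.inl ⟨hvu, h⟩) fun h h' => h h'.2)
    · rintro ⟨h1, h2, h3⟩
      refine ⟨h2, fun v hv => ?_⟩
      rcases hv with (hv | hv) | hv
      · exact h3 v (Or.inl hv.2)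
      · exact h1 v hv
      · by_cases hvu : v = u
        · exact h3 v (Or.inl (hvu ▸ huJ))
        · exact h3 v (Or.inr fun h => hv ⟨hvu, h⟩)

/-- The deletion identity and the color symmetry express every `rootedCount` through smaller `W`, so
it depends polynomially on the number `q + 1` of colors. -/
theorem exists_rootedPolynomial (W : Finset V) : ∀ J : Finset V, ∃ P : ℤ[X], J ⊆ W →
    ∀ q : ℕ, P.eval ((q : ℤ) + 1) = G.rootedCount q W J := by
  classical
  induction W using Finset.strongInduction with
  | H W ih =>
  -- A nonempty `J` reduces to smaller `W`, and `J = ∅` reduces to a singleton `J`.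
  have hne : ∀ J : Finset V, J.Nonempty → ∃ P : ℤ[X], J ⊆ W →
      ∀ q : ℕ, P.eval ((q : ℤ) + 1) = G.rootedCount q W J := by
    rintro J ⟨u, hu⟩
    by_cases huW : u ∈ W
    · choose P hP using ih (W.erase u) (Finset.erase_ssubset huW)
      refine ⟨∑ K ∈ ({w ∈ W | G.Adj u w} : Finset V).powerset,
        (-1) ^ #K * P (J.erase u ∪ K), fun hJ q => ?_⟩
      rw [G.rootedCount_eq_sum q huW hu, Polynomial.eval_finsetSum]
      refine Finset.sum_congr rfl fun K hK => ?_
      rw [Polynomial.eval_mul, hP _ (erase_union_subset G hJ hK)]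
      simp
    · exact ⟨0, fun hJ => absurd (hJ hu) huW⟩
  intro J
  rcases J.eq_empty_or_nonempty with rfl | hJ
  · rcases W.eq_empty_or_nonempty with rfl | ⟨u, hu⟩
    · exact ⟨1, fun _ q => by simp [rootedCount_empty]⟩
    · obtain ⟨P, hP⟩ := hne {u} (Finset.singleton_nonempty u)
      refine ⟨X * P, fun _ q => ?_⟩
      rw [Polynomial.eval_mul, hP (Finset.singleton_subset_iff.2 hu), Polynomial.eval_X,
        G.rootedCount_empty_right q hu]
      push_cast
      rfl
  · exact hne J hJ

/-- The polynomial that counts the proper colorings of `G[W]` in which all of `J` has one fixed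
color; it is meaningful for `J ⊆ W`. -/
noncomputable def rootedPolynomial (W J : Finset V) : ℤ[X] :=
  (G.exists_rootedPolynomial W J).choose

variable {G}

theorem rootedPolynomial_eval {W J : Finset V} (hJ : J ⊆ W) (q : ℕ) :
    (G.rootedPolynomial W J).eval ((q : ℤ) + 1) = G.rootedCount q W J :=
  (G.exists_rootedPolynomial W J).choose_spec hJ q

theorem polynomial_ext_of_eval_succ {P Q : ℤ[X]}
    (h : ∀ q : ℕ, P.eval ((q : ℤ) + 1) = Q.eval ((q : ℤ) + 1)) : P = Q := by
  refine Polynomial.eq_of_infinite_eval_eq _ _ (Set.Infinite.mono ?_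
    (Set.infinite_range_of_injective (f := fun n : ℕ => (n : ℤ) + 1) fun a b h => by simpa using h))
  rintro _ ⟨n, rfl⟩
  exact h n

theorem rootedPolynomial_empty : G.rootedPolynomial ∅ ∅ = 1 :=
  polynomial_ext_of_eval_succ fun q => by
    rw [rootedPolynomial_eval subset_rfl, rootedCount_empty]
    simp

theorem rootedPolynomial_eq_zero {W J : Finset V} (hJ : J ⊆ W)
    (h : ¬ G.IsIndepSet (J : Set V)) : G.rootedPolynomial W J = 0 :=
  polynomial_ext_of_eval_succ fun q => by
    rw [rootedPolynomial_eval hJ, rootedCount_eq_zero G q hJ h]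
    simp

theorem rootedPolynomial_univ : G.rootedPolynomial univ ∅ = G.chromaticPolynomial :=
  polynomial_ext_of_eval_succ fun q => by
    rw [rootedPolynomial_eval (Finset.empty_subset _), rootedCount_univ]
    exact_mod_cast ((chromaticPolynomial_spec G).2.2 (q + 1) q.succ_pos).symm

/-- `χ_{G[W]}(q) = q * N_{u}(q)`, by the symmetry of the colors. -/
theorem rootedPolynomial_empty_right {W : Finset V} {u : V} (hu : u ∈ W) :
    G.rootedPolynomial W ∅ = X * G.rootedPolynomial W {u} :=
  polynomial_ext_of_eval_succ fun q => by
    rw [rootedPolynomial_eval (Finset.empty_subset _), Polynomial.eval_mul,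
      rootedPolynomial_eval (Finset.singleton_subset_iff.2 hu), Polynomial.eval_X,
      rootedCount_empty_right G q hu]
    push_cast
    rfl

open Classical in
theorem rootedPolynomial_eq_sum {W J : Finset V} {u : V} (hJ : J ⊆ W) (hu : u ∈ J) :
    G.rootedPolynomial W J = ∑ K ∈ ({w ∈ W | G.Adj u w} : Finset V).powerset,
      (-1) ^ #K * G.rootedPolynomial (W.erase u) (J.erase u ∪ K) :=
  polynomial_ext_of_eval_succ fun q => by
    rw [rootedPolynomial_eval hJ, rootedCount_eq_sum G q (hJ hu) hu, Polynomial.eval_finsetSum]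
    refine Finset.sum_congr rfl fun K hK => ?_
    rw [Polynomial.eval_mul, rootedPolynomial_eval (erase_union_subset G hJ hK)]
    simp

end Count

/-! ### The zero-free region -/

section ZeroFree

variable {G : SimpleGraph V}

open Classical in
/-- The constant `7` is chosen such that `c * D ≤ 2 / 7` makes the bound of `indepSum_le` equal to
`(1 + 1) ^ 2`. -/
theorem indepSum_neighbors_le (hG : G.IsClawFree) {D : ℕ}
    (hD : ∀ u, ∀ N : Finset V, (∀ w ∈ N, G.Adj u w) → #N ≤ D) {c : ℝ} (hc : 0 ≤ c)
    (hcD : c * D ≤ 2 / 7) (W : Finset V) (u : V) :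
    G.indepSum (7 * c) {w ∈ W | G.Adj u w} ≤ 4 := by
  have hcard : (#{w ∈ W | G.Adj u w} : ℝ) ≤ D := by
    exact_mod_cast hD u _ fun w hw => (Finset.mem_filter.1 hw).2
  refine (G.indepSum_le (by positivity) _ fun x hx y hy w hw => hG.exists_adj
    (Finset.mem_filter.1 hx).2 (Finset.mem_filter.1 hy).2 (Finset.mem_filter.1 hw).2).trans ?_
  have h1 := mul_le_mul_of_nonneg_left hcard hc
  have h2 : 0 ≤ c * (#{w ∈ W | G.Adj u w} : ℝ) := by positivity
  nlinarith

open Classical in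
/-- The zero-free region `7 / 2 * D ≤ ‖z‖`, with the two estimates that carry the induction: a lower
bound for the value of the chromatic polynomial relative to that of a vertex-deleted subgraph, and
an upper bound for the polynomials with a monochromatic set `J`. -/
theorem norm_aeval_rootedPolynomial_le [Fintype V] (hG : G.IsClawFree) {D : ℕ}
    (hD : ∀ u, ∀ N : Finset V, (∀ w ∈ N, G.Adj u w) → #N ≤ D) {z : ℂ} (hz : z ≠ 0)
    (hzD : ‖z‖⁻¹ * D ≤ 2 / 7) (W : Finset V) :
    aeval z (G.rootedPolynomial W ∅) ≠ 0 ∧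
    (∀ u ∈ W, ‖aeval z (G.rootedPolynomial (W.erase u) ∅)‖ ≤
      7 / 4 * ‖z‖⁻¹ * ‖aeval z (G.rootedPolynomial W ∅)‖) ∧
    ∀ J ⊆ W, J.Nonempty → 7 * ‖aeval z (G.rootedPolynomial W J)‖ ≤
      (7 * ‖z‖⁻¹) ^ #J * ‖aeval z (G.rootedPolynomial W ∅)‖ := by
  classical
  induction W using Finset.strongInduction with
  | H W ih =>
  obtain ⟨c, hc⟩ : ∃ c, c = ‖z‖⁻¹ := ⟨_, rfl⟩
  have hc0 : 0 < c := by rw [hc]; positivity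
  have hcz : c * ‖z‖ = 1 := by rw [hc]; exact inv_mul_cancel₀ (norm_ne_zero_iff.2 hz)
  rw [← hc] at hzD ih ⊢
  have hsum : ∀ u, G.indepSum (7 * c) {w ∈ W | G.Adj u w} ≤ 4 := fun u =>
    indepSum_neighbors_le hG hD hc0.le hzD W u
  have hsingle : ∀ u ∈ W, aeval z (G.rootedPolynomial W ∅) =
      z * aeval z (G.rootedPolynomial W {u}) := by
    intro u hu
    rw [rootedPolynomial_empty_right hu, map_mul, aeval_X]
  have hrec : ∀ u, ∀ J ⊆ W, u ∈ J → aeval z (G.rootedPolynomial W J) =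
      ∑ K ∈ ({w ∈ W | G.Adj u w} : Finset V).powerset,
        (-1) ^ #K * aeval z (G.rootedPolynomial (W.erase u) (J.erase u ∪ K)) := by
    intro u J hJ hu
    rw [rootedPolynomial_eq_sum hJ hu, map_sum]
    simp
  have hdel : ∀ u ∈ W, ‖aeval z (G.rootedPolynomial (W.erase u) ∅)‖ ≤
      7 / 4 * c * ‖aeval z (G.rootedPolynomial W ∅)‖ := by
    intro u hu
    obtain ⟨-, -, ihJ⟩ := ih _ (Finset.erase_ssubset hu)
    set E := aeval z (G.rootedPolynomial (W.erase u) ∅) with hE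
    obtain ⟨N, hN⟩ : ∃ N : Finset V, N = {w ∈ W | G.Adj u w} := ⟨_, rfl⟩
    -- The term `K = ∅` of the deletion identity is `E`; all others together are at most `3/7 * ‖E‖`.
    have hterm : ∀ K ∈ N.powerset.erase ∅,
        7 * ‖(-1) ^ #K * aeval z (G.rootedPolynomial (W.erase u) (({u} : Finset V).erase u ∪ K))‖ ≤
          (if G.IsIndepSet (K : Set V) then (7 * c) ^ #K else 0) * ‖E‖ := by
      intro K hK
      rw [Finset.mem_erase] at hK
      have hKW : K ⊆ W.erase u := by
        have := erase_union_subset G (J := {u}) (by simpa using hu) (hN ▸ hK.2)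
        exact Finset.union_subset_right this
      rw [norm_mul, norm_pow, norm_neg, norm_one, one_pow, one_mul, Finset.erase_singleton,
        Finset.empty_union]
      split_ifs with hI
      · exact ihJ K hKW (Finset.nonempty_iff_ne_empty.2 hK.1)
      · simp [rootedPolynomial_eq_zero hKW hI]
    have hS : ∑ K ∈ N.powerset.erase ∅,
        (if G.IsIndepSet (K : Set V) then (7 * c) ^ #K else 0) ≤ 3 := by
      have h := hsum u
      rw [← hN, indepSum, ← Finset.add_sum_erase _ _ (Finset.empty_mem_powerset N)] at h
      simp only [Finset.coe_empty, Finset.card_empty, pow_zero] at h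
      rw [if_pos (by simp [SimpleGraph.IsIndepSet])] at h
      linarith
    have hrest : 7 * ‖∑ K ∈ N.powerset.erase ∅, (-1) ^ #K *
        aeval z (G.rootedPolynomial (W.erase u) (({u} : Finset V).erase u ∪ K))‖ ≤ 3 * ‖E‖ := by
      refine (mul_le_mul_of_nonneg_left (norm_sum_le _ _) (by norm_num)).trans ?_
      rw [Finset.mul_sum]
      refine (Finset.sum_le_sum hterm).trans ?_
      rw [← Finset.sum_mul]
      exact mul_le_mul_of_nonneg_right hS (norm_nonneg _)
    have hu1 := hrec u {u} (by simpa using hu) (Finset.mem_singleton_self u)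
    rw [← hN, ← Finset.add_sum_erase _ _ (Finset.empty_mem_powerset N)] at hu1
    simp only [Finset.card_empty, pow_zero, one_mul, Finset.erase_singleton,
      Finset.union_empty] at hu1 hrest
    rw [← hE] at hu1
    have h1 : ‖E‖ ≤ ‖aeval z (G.rootedPolynomial W {u})‖ + 3 / 7 * ‖E‖ := by
      rw [hu1]
      have := norm_sub_le_norm_add E (∑ K ∈ N.powerset.erase ∅, (-1) ^ #K *
        aeval z (G.rootedPolynomial (W.erase u) (∅ ∪ K)))
      linarith
    have h2 : c * ‖aeval z (G.rootedPolynomial W ∅)‖ =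
        ‖aeval z (G.rootedPolynomial W {u})‖ := by
      rw [hsingle u hu, norm_mul, ← mul_assoc, hcz, one_mul]
    linarith
  refine ⟨?_, hdel, ?_⟩
  · rcases W.eq_empty_or_nonempty with rfl | ⟨u, hu⟩
    · simp [rootedPolynomial_empty]
    · intro h0
      have h := hdel u hu
      rw [h0, norm_zero, mul_zero] at h
      exact (ih _ (Finset.erase_ssubset hu)).1 (norm_le_zero_iff.1 h)
  · rintro J hJ ⟨u, hu⟩
    by_cases hI : G.IsIndepSet (J : Set V)
    swap
    · rw [rootedPolynomial_eq_zero hJ hI]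
      simp
      positivity
    rcases (J.erase u).eq_empty_or_nonempty with hJu | hJu
    · -- A single vertex: equality, by the symmetry of the colors.
      have hJ1 : J = {u} := by
        rw [← Finset.insert_erase hu, hJu]
        simp
      rw [hJ1, hsingle u (hJ hu), norm_mul, Finset.card_singleton, pow_one]
      refine le_of_eq ?_
      linear_combination (-7 * ‖aeval z (G.rootedPolynomial W {u})‖) * hcz
    · obtain ⟨-, -, ihJ⟩ := ih _ (Finset.erase_ssubset (hJ hu))
      set E := aeval z (G.rootedPolynomial (W.erase u) ∅) with hE
      obtain ⟨N, hN⟩ : ∃ N : Finset V, N = {w ∈ W | G.Adj u w} := ⟨_, rfl⟩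
      have hterm : ∀ K ∈ N.powerset,
          7 * ‖(-1) ^ #K * aeval z (G.rootedPolynomial (W.erase u) (J.erase u ∪ K))‖ ≤
            (if G.IsIndepSet (K : Set V) then (7 * c) ^ #K else 0) *
              ((7 * c) ^ #(J.erase u) * ‖E‖) := by
        intro K hK
        have hKW : J.erase u ∪ K ⊆ W.erase u := erase_union_subset G hJ (hN ▸ hK)
        rw [norm_mul, norm_pow, norm_neg, norm_one, one_pow, one_mul]
        split_ifs with hIK
        · have hdisj : Disjoint (J.erase u) K := by
            rw [Finset.disjoint_left]
            intro w hw hwK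
            have hadj : G.Adj u w := by
              have := Finset.mem_powerset.1 hK hwK
              rw [hN] at this
              exact (Finset.mem_filter.1 this).2
            exact hI hu (Finset.mem_of_mem_erase hw) hadj.ne hadj
          refine (ihJ _ hKW (hJu.mono Finset.subset_union_left)).trans (le_of_eq ?_)
          rw [Finset.card_union_of_disjoint hdisj]
          ring
        · rw [rootedPolynomial_eq_zero hKW fun h => hIK
            (h.mono (by exact_mod_cast Finset.subset_union_right))]
          simp
      have hle : 7 * ‖aeval z (G.rootedPolynomial W J)‖ ≤
          4 * ((7 * c) ^ #(J.erase u) * ‖E‖) := by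
        rw [hrec u J hJ hu, ← hN]
        refine (mul_le_mul_of_nonneg_left (norm_sum_le _ _) (by norm_num)).trans ?_
        rw [Finset.mul_sum]
        refine (Finset.sum_le_sum hterm).trans ?_
        rw [← Finset.sum_mul]
        exact mul_le_mul_of_nonneg_right (hN ▸ hsum u) (by positivity)
      refine hle.trans ?_
      rw [← Finset.card_erase_add_one hu, pow_succ]
      have := mul_le_mul_of_nonneg_left (hdel u (hJ hu))
        (show 0 ≤ 4 * (7 * c) ^ #(J.erase u) by positivity)
      linarith

end ZeroFree

end SimpleGraph

theorem theorem3 {V : Type*} [Fintype V] (G : SimpleGraph V) [DecidableRel G.Adj]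
    (hG : G.IsClawFree) (z : ℂ) (hz : Polynomial.aeval z G.chromaticPolynomial = 0) :
    ‖z‖ ≤ 3.81 * (G.maxDegree : ℝ) := by
  by_contra! h
  have hD : ∀ u, ∀ N : Finset V, (∀ w ∈ N, G.Adj u w) → N.card ≤ G.maxDegree := fun u N hN =>
    (Finset.card_le_card fun w hw => (G.mem_neighborFinset u w).2 (hN w hw)).trans
      (G.degree_le_maxDegree u)
  have hpos : 0 < ‖z‖ := lt_of_le_of_lt (by positivity) h
  refine (SimpleGraph.norm_aeval_rootedPolynomial_le hG hD (norm_pos_iff.1 hpos) ?_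
    Finset.univ).1 (by rw [SimpleGraph.rootedPolynomial_univ, hz])
  rw [inv_mul_le_iff₀ hpos]
  have : (0 : ℝ) ≤ G.maxDegree := Nat.cast_nonneg _
  linarith
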